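/- Let $c>0$. For $n=0,1,2,\dots$ let $\chi_n(c)$ be the eigenvalues, in increasing order, of the Sturm--Liouville operator $$\mathcal L_c\psi=-\frac{d}{dx}\Big[(1-x^2)\frac{d\psi}{dx}\Big]+c^2x^2\psi$$ on $[-1,1]$ (with eigenfunctions that are $C^2$ up to the end points), and let $\psi_n=\psi_{n,c}$ be the corresponding prolate spheroidal wave function, that is, the real eigenfunction of $\mathcal L_c$ for $\chi_n(c)$ with $\int_{-1}^1\psi_n(x)^2\,dx=1$, $\psi_n(0)>0$ if $n$ is even and $\psi_n'(0)>0$ if $n$ is odd. Let $\beta_k^n=\int_{-1}^1\psi_n(x)\,\overline{P_k}(x)\,dx$, where $\overline{P_k}=\sqrt{k+1/2}\,P_k$ is the Legendre polynomial of degree $k$ normalized in $L^2([-1,1])$, and let $q=c^2/\chi_n(c)$. Then, for all positive integers $n,k$ such that $k(k-1)+1.13\,c^2\le\chi_n(c)$, the function $\psi_n$ is also an eigenfunction of the finite Fourier transform, $\int_{-1}^1e^{icxy}\psi_n(y)\,dy=\mu_n(c)\,\psi_n(x)$ for all $x\in[-1,1]$ with some $\mu_n(c)\in\mathbb C$ (necessarily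 unique), and $$|\beta_0^n|\le\frac1{\sqrt2}\,|\mu_n(c)|\qquad\text{and}\qquad|\beta_k^n|\le\sqrt{\frac5{4\pi}}\Big(\frac2{\sqrt q}\Big)^k|\mu_n(c)|.$$ -/

import Mathlib

open Set

noncomputable section

/-- The Sturm-Liouville operator `L_c ψ = -((1 - x²) ψ')' + c² x² ψ`, evaluated at `x`. -/
def sturmLiouvilleOp (c : ℝ) (ψ : ℝ → ℝ) (x : ℝ) : ℝ :=
  -deriv (fun t : ℝ => (1 - t ^ 2) * deriv ψ t) x + c ^ 2 * x ^ 2 * ψ x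

/-- `ψ` is an eigenfunction of `L_c` on `[-1, 1]` for the eigenvalue `χ`. The equation is singular
at `±1`; twice continuous differentiability up to the end points selects the usual self-adjoint
realization of `L_c` (all of whose eigenfunctions are smooth up to the end points), and excludes
the solutions with a logarithmic singularity. -/
structure IsSturmLiouvilleEigenfunction (c χ : ℝ) (ψ : ℝ → ℝ) : Prop where
  contDiffOn : ContDiffOn ℝ 2 ψ (Icc (-1) 1)
  eigen : ∀ x ∈ Ioo (-1 : ℝ) 1, sturmLiouvilleOp c ψ x = χ * ψ x
  nonzero : ∃ x ∈ Icc (-1 : ℝ) 1, ψ x ≠ 0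

/-- `χ` is an eigenvalue of `L_c`. -/
def IsSturmLiouvilleEigenvalue (c χ : ℝ) : Prop :=
  ∃ ψ : ℝ → ℝ, IsSturmLiouvilleEigenfunction c χ ψ

/-- `χ = χ_n(c)`: the `n`-th eigenvalue of `L_c`, for `n = 0, 1, 2, …` in increasing order, that
is, the eigenvalue below which there are exactly `n` others. -/
def IsNthSturmLiouvilleEigenvalue (c : ℝ) (n : ℕ) (χ : ℝ) : Prop :=
  IsSturmLiouvilleEigenvalue c χ ∧
    {χ' : ℝ | IsSturmLiouvilleEigenvalue c χ' ∧ χ' < χ}.encard = n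

/-- `ψ` is, on `[-1, 1]`, the `n`-th prolate spheroidal wave function `ψ_{n,c}` of bandwidth `c`,
and `χ = χ_n(c)`: an eigenfunction of `L_c` for the `n`-th eigenvalue, of norm one in
`L²([-1, 1])`, with the sign fixed by `ψ(0) > 0` for even `n` and `ψ'(0) > 0` for odd `n`. -/
structure IsPSWF (c : ℝ) (n : ℕ) (χ : ℝ) (ψ : ℝ → ℝ) : Prop where
  nthEigenvalue : IsNthSturmLiouvilleEigenvalue c n χ
  eigenfunction : IsSturmLiouvilleEigenfunction c χ ψ
  normalized : ∫ x in (-1 : ℝ)..1, ψ x ^ 2 = 1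
  sign_even : Even n → 0 < ψ 0
  sign_odd : Odd n → 0 < deriv ψ 0

/-- The finite Fourier transform `F_c f (x) = ∫_{-1}^1 exp(i c x y) f(y) dy`. -/
def finiteFourier (c : ℝ) (f : ℝ → ℝ) (x : ℝ) : ℂ :=
  ∫ y in (-1 : ℝ)..1, Complex.exp (Complex.I * c * x * y) * (f y : ℂ)

/-- The Legendre polynomial `P_k` (Rodrigues' formula). -/
def legendrePoly (k : ℕ) : Polynomial ℝ :=
  Polynomial.C (1 / ((2 : ℝ) ^ k * (k.factorial : ℝ))) *
    (Polynomial.derivative^[k] ((Polynomial.X ^ 2 - 1) ^ k))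

/-- The Legendre polynomial normalized in `L²([-1, 1])`: `√(k + 1/2) P_k(x)`. -/
def normalizedLegendre (k : ℕ) (x : ℝ) : ℝ :=
  Real.sqrt ((k : ℝ) + 1 / 2) * (legendrePoly k).eval x

/-- The coefficient of `ψ` on the `k`-th normalized Legendre polynomial, in the expansion of `ψ`
in the orthonormal basis of `L²([-1, 1])` that these polynomials form. -/
def legendreCoeff (ψ : ℝ → ℝ) (k : ℕ) : ℝ :=
  ∫ x in (-1 : ℝ)..1, ψ x * normalizedLegendre k x

end

/-!
Let `γ_j = ∫ ψ P_j`. Since `L_c` is symmetric, Legendre's equation and Bonnet's recursion turn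
`L_c ψ = χ ψ` into the three-term recurrence
`(χ - j (j + 1)) γ_j = c² (A_j γ_{j+2} + B_j γ_j + C_j γ_{j-2})`, where
`x² P_j = A_j P_{j+2} + B_j P_j + C_j P_{j-2}`. The coefficients are nonnegative and add up to `1`
(evaluate at `x = 1`), so as long as `j (j + 1) + c² ≤ χ` the `γ_j` of one parity keep their sign
and do not decrease in absolute value; dropping nonnegative terms then gives
`|γ_{j+2}| ≤ (χ / c²) |γ_j| / A_j` (`abs_le_of_recurrence`). The product of the `1 / A_j` is the
leading coefficient of `P_k`, which together with the normalization `√(k + 1/2)` is at most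
`√(5 / (4π)) 2^k` (`sqrt_mul_legendreLead_le`). It remains to bound `γ_0` by `|μ|` and `γ_1` by
`|μ| √χ / c`.

`L_c` commutes with the cosine and sine transforms of kernel `cos (cxy)` and `sin (cxy)`
(`IsProlateSolution.integral_kernel`), and its eigenspaces have dimension one
(`IsProlateSolution.exists_eq_mul`), so `ψ` is an eigenfunction of the finite Fourier transform.
Evaluating this and its derivative at `0` gives `|γ_0| ≤ |μ| |ψ(0)|` and `c |γ_1| ≤ |μ| |ψ'(0)|`.

Finally `ψ(0)² + ψ'(0)² / χ ≤ 1` (`IsProlateSolution.sq_add_deriv_sq_div_le_one`). The function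
`ψ² + (1 - x²) ψ'² / (χ - c²x²)` is smallest at `0`; integrating it against `χ - c²x²` bounds
`(ψ(0)² + ψ'(0)² / χ) (2χ - 2c²/3)` by `2χ - 2c² ∫ x² ψ²`, so it suffices that
`∫ x² ψ² ≥ 1/3`. That follows from a virial identity and the lower bound `χ ≥ 2`, which holds as
soon as `c² < χ`.
-/

/-! ### Calculus on `[-1, 1]` -/

lemma intervalIntegrable_of_cont {u : ℝ → ℝ} (h : ContinuousOn u (Icc (-1) 1)) :
    IntervalIntegrable u MeasureTheory.volume (-1) 1 :=
  ContinuousOn.intervalIntegrable_of_Icc (by norm_num) h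

lemma integral_eq_zero_of_hasDerivAt {G g : ℝ → ℝ} (hG : ContinuousOn G (Icc (-1) 1))
    (hg : ContinuousOn g (Icc (-1) 1)) (hd : ∀ x ∈ Ioo (-1 : ℝ) 1, HasDerivAt G (g x) x)
    (h : G 1 = G (-1)) : ∫ x in (-1 : ℝ)..1, g x = 0 := by
  rw [intervalIntegral.integral_eq_sub_of_hasDerivAt_of_le (by norm_num) hG hd
    (intervalIntegrable_of_cont hg), h, sub_self]

/-- A function whose derivative has the sign of `x` is smallest at `0`. -/
lemma apply_zero_le_of_hasDerivAt_mul {Q g : ℝ → ℝ} (hQ : ContinuousOn Q (Icc (-1) 1))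
    (hd : ∀ x ∈ Ioo (-1 : ℝ) 1, HasDerivAt Q (x * g x) x) (hg : ∀ x ∈ Ioo (-1 : ℝ) 1, 0 ≤ g x)
    {x : ℝ} (hx : x ∈ Icc (-1 : ℝ) 1) : Q 0 ≤ Q x := by
  rcases le_total 0 x with h0 | h0
  · have hm : MonotoneOn Q (Icc 0 1) := by
      refine monotoneOn_of_hasDerivWithinAt_nonneg (f' := fun x => x * g x) (convex_Icc 0 1)
        (hQ.mono (Icc_subset_Icc (by norm_num) le_rfl)) ?_ ?_
      · intro y hy
        rw [interior_Icc] at hy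
        exact (hd y ⟨by linarith [hy.1], hy.2⟩).hasDerivWithinAt
      · intro y hy
        rw [interior_Icc] at hy
        exact mul_nonneg hy.1.le (hg y ⟨by linarith [hy.1], hy.2⟩)
    exact hm ⟨le_rfl, zero_le_one⟩ ⟨h0, hx.2⟩ h0
  · have hm : AntitoneOn Q (Icc (-1) 0) := by
      refine antitoneOn_of_hasDerivWithinAt_nonpos (f' := fun x => x * g x) (convex_Icc (-1) 0)
        (hQ.mono (Icc_subset_Icc le_rfl (by norm_num))) ?_ ?_
      · intro y hy
        rw [interior_Icc] at hy
        exact (hd y ⟨hy.1, by linarith [hy.2]⟩).hasDerivWithinAt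
      · intro y hy
        rw [interior_Icc] at hy
        exact mul_nonpos_of_nonpos_of_nonneg hy.2.le (hg y ⟨hy.1, by linarith [hy.2]⟩)
    exact hm ⟨hx.1, h0⟩ ⟨by norm_num, le_rfl⟩ h0

/-! ### Solutions of the spheroidal wave equation -/

/-- `f` is a solution of `((1 - x²) f')' + (χ - c² x²) f = 0` on `(-1, 1)` that is `C²` up to the
end points; `f₁` and `f₂` are its first two derivatives, extended continuously to `[-1, 1]`. No
condition is put on `f` outside `[-1, 1]`. -/
structure IsProlateSolution (c χ : ℝ) (f f₁ f₂ : ℝ → ℝ) : Prop where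
  cont : ContinuousOn f (Icc (-1) 1)
  cont₁ : ContinuousOn f₁ (Icc (-1) 1)
  cont₂ : ContinuousOn f₂ (Icc (-1) 1)
  hasDerivAt : ∀ x ∈ Ioo (-1 : ℝ) 1, HasDerivAt f (f₁ x) x
  hasDerivAt₁ : ∀ x ∈ Ioo (-1 : ℝ) 1, HasDerivAt f₁ (f₂ x) x
  ode : ∀ x ∈ Ioo (-1 : ℝ) 1,
    (1 - x ^ 2) * f₂ x - 2 * x * f₁ x + (χ - c ^ 2 * x ^ 2) * f x = 0

theorem IsSturmLiouvilleEigenfunction.exists_isProlateSolution {c χ : ℝ} {ψ : ℝ → ℝ}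
    (h : IsSturmLiouvilleEigenfunction c χ ψ) :
    ∃ ψ₁ ψ₂ : ℝ → ℝ, IsProlateSolution c χ ψ ψ₁ ψ₂ := by
  have hu : UniqueDiffOn ℝ (Icc (-1 : ℝ) 1) := uniqueDiffOn_Icc (by norm_num)
  have hc1 : ContDiffOn ℝ 1 (derivWithin ψ (Icc (-1) 1)) (Icc (-1) 1) :=
    h.contDiffOn.derivWithin hu (by norm_num)
  have key : ∀ {f : ℝ → ℝ}, DifferentiableOn ℝ f (Icc (-1) 1) → ∀ x ∈ Ioo (-1 : ℝ) 1,
      HasDerivAt f (derivWithin f (Icc (-1) 1) x) x := fun hf x hx =>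
    ((hf x (Ioo_subset_Icc_self hx)).hasDerivWithinAt).hasDerivAt (Icc_mem_nhds hx.1 hx.2)
  have h0 := key (h.contDiffOn.differentiableOn (by norm_num))
  have h1 := key (hc1.differentiableOn (by norm_num))
  refine ⟨derivWithin ψ (Icc (-1) 1), derivWithin (derivWithin ψ (Icc (-1) 1)) (Icc (-1) 1),
    h.contDiffOn.continuousOn, hc1.continuousOn, hc1.continuousOn_derivWithin hu le_rfl,
    h0, h1, fun x hx => ?_⟩
  have hev : (fun t : ℝ => (1 - t ^ 2) * deriv ψ t) =ᶠ[nhds x]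
      fun t => (1 - t ^ 2) * derivWithin ψ (Icc (-1) 1) t := by
    filter_upwards [Ioo_mem_nhds hx.1 hx.2] with t ht
    rw [(h0 t ht).deriv]
  have hd := (((hasDerivAt_pow 2 x).const_sub 1).mul (h1 x hx)).deriv
  have he := h.eigen x hx
  rw [sturmLiouvilleOp, hev.deriv_eq] at he
  change deriv (fun t => (1 - t ^ 2) * derivWithin ψ (Icc (-1) 1) t) x = _ at hd
  rw [hd] at he
  push_cast at he
  linear_combination -he

lemma hasDerivAt_one_sub_sq (x : ℝ) : HasDerivAt (fun t : ℝ => 1 - t ^ 2) (-2 * x) x :=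
  ((hasDerivAt_pow 2 x).const_sub 1).congr_deriv (by push_cast; ring)

lemma hasDerivAt_potential (c χ x : ℝ) :
    HasDerivAt (fun t : ℝ => χ - c ^ 2 * t ^ 2) (-2 * c ^ 2 * x) x :=
  (((hasDerivAt_pow 2 x).const_mul (c ^ 2)).const_sub χ).congr_deriv (by push_cast; ring)

lemma potential_pos {c χ : ℝ} (hcχ : c ^ 2 < χ) {x : ℝ} (hx : x ∈ Icc (-1 : ℝ) 1) :
    0 < χ - c ^ 2 * x ^ 2 := by
  have : x ^ 2 ≤ 1 := by nlinarith [hx.1, hx.2]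
  nlinarith [mul_le_mul_of_nonneg_left this (sq_nonneg c)]

lemma one_sub_sq_nonneg {x : ℝ} (hx : x ∈ Icc (-1 : ℝ) 1) : 0 ≤ 1 - x ^ 2 := by
  nlinarith [hx.1, hx.2]

namespace IsProlateSolution

variable {c χ : ℝ} {f f₁ f₂ g g₁ g₂ : ℝ → ℝ}

lemma sub_const_mul (hf : IsProlateSolution c χ f f₁ f₂) (hg : IsProlateSolution c χ g g₁ g₂)
    (m : ℝ) : IsProlateSolution c χ (fun x => f x - m * g x) (fun x => f₁ x - m * g₁ x)
      (fun x => f₂ x - m * g₂ x) where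
  cont := hf.cont.sub (continuousOn_const.mul hg.cont)
  cont₁ := hf.cont₁.sub (continuousOn_const.mul hg.cont₁)
  cont₂ := hf.cont₂.sub (continuousOn_const.mul hg.cont₂)
  hasDerivAt x hx := (hf.hasDerivAt x hx).sub ((hg.hasDerivAt x hx).const_mul m)
  hasDerivAt₁ x hx := (hf.hasDerivAt₁ x hx).sub ((hg.hasDerivAt₁ x hx).const_mul m)
  ode x hx := by linear_combination hf.ode x hx - m * hg.ode x hx

/-- `(1 - x²) W(f, g)` is constant on `[-1, 1]` and vanishes at `1`, because both solutions are
`C¹` up to the end point. -/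
lemma wronskian_zero (hf : IsProlateSolution c χ f f₁ f₂) (hg : IsProlateSolution c χ g g₁ g₂) :
    f 0 * g₁ 0 = f₁ 0 * g 0 := by
  have key : ∀ {x : ℝ}, x ∈ Icc (-1 : ℝ) 1 →
      (1 - (0 : ℝ) ^ 2) * (f 0 * g₁ 0 - f₁ 0 * g 0) ≤ (1 - x ^ 2) * (f x * g₁ x - f₁ x * g x) ∧
      (-1) * ((1 - (0 : ℝ) ^ 2) * (f 0 * g₁ 0 - f₁ 0 * g 0)) ≤
        (-1) * ((1 - x ^ 2) * (f x * g₁ x - f₁ x * g x)) := by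
    intro x hx
    have hc : ContinuousOn (fun x => (1 - x ^ 2) * (f x * g₁ x - f₁ x * g x)) (Icc (-1) 1) := by
      have := hf.cont; have := hf.cont₁; have := hg.cont; have := hg.cont₁
      fun_prop
    have hd : ∀ x ∈ Ioo (-1 : ℝ) 1,
        HasDerivAt (fun x => (1 - x ^ 2) * (f x * g₁ x - f₁ x * g x)) (x * 0) x := by
      intro x hx
      refine ((hasDerivAt_one_sub_sq x).mul (((hf.hasDerivAt x hx).mul (hg.hasDerivAt₁ x hx)).sub
        ((hf.hasDerivAt₁ x hx).mul (hg.hasDerivAt x hx)))).congr_deriv ?_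
      simp only [Pi.mul_apply, Pi.sub_apply]
      linear_combination f x * hg.ode x hx - g x * hf.ode x hx
    refine ⟨apply_zero_le_of_hasDerivAt_mul hc hd (fun _ _ => le_rfl) hx, ?_⟩
    exact apply_zero_le_of_hasDerivAt_mul (continuousOn_const.mul hc)
      (fun x hx => ((hd x hx).const_mul (-1)).congr_deriv (by ring)) (fun _ _ => le_rfl) hx
  obtain ⟨h1, h2⟩ := key (x := 1) (by norm_num)
  norm_num at h1 h2
  linarith

/-- The energy `(1 - x²) (χ - c² x²) f² + ((1 - x²) f')²` is largest at `0`, so that a solution with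
zero Cauchy data there vanishes. -/
lemma eq_zero_of_zero_data (hcχ : c ^ 2 < χ) (hf : IsProlateSolution c χ f f₁ f₂)
    (h0 : f 0 = 0) (h1 : f₁ 0 = 0) : ∀ x ∈ Icc (-1 : ℝ) 1, f x = 0 := by
  have hIoo : ∀ x ∈ Ioo (-1 : ℝ) 1, f x = 0 := by
    intro x hx
    have hQ : ContinuousOn (fun x => -((1 - x ^ 2) * (χ - c ^ 2 * x ^ 2) * f x ^ 2 +
        ((1 - x ^ 2) * f₁ x) ^ 2)) (Icc (-1) 1) := by
      have := hf.cont; have := hf.cont₁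
      fun_prop
    have h := apply_zero_le_of_hasDerivAt_mul hQ
      (g := fun x => (2 * (χ - c ^ 2 * x ^ 2) + 2 * c ^ 2 * (1 - x ^ 2)) * f x ^ 2)
      (fun x hx => ?_) (fun x hx => ?_) (Ioo_subset_Icc_self hx)
    · simp only [h0, h1] at h
      have hp : 0 < 1 - x ^ 2 := by nlinarith [hx.1, hx.2]
      have hr := potential_pos hcχ (Ioo_subset_Icc_self hx)
      have hpr := mul_pos hp hr
      by_contra hne
      have := mul_pos hpr (pow_pos (abs_pos.2 hne) 2)
      rw [sq_abs] at this
      nlinarith [sq_nonneg ((1 - x ^ 2) * f₁ x)]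
    · have hp := hasDerivAt_one_sub_sq x
      refine ((((hp.mul (hasDerivAt_potential c χ x)).mul ((hf.hasDerivAt x hx).pow 2)).add
        ((hp.mul (hf.hasDerivAt₁ x hx)).pow 2)).neg).congr_deriv ?_
      simp only [Pi.mul_apply, Pi.pow_apply]
      push_cast
      linear_combination (-2 * (1 - x ^ 2) * f₁ x) * hf.ode x hx
    · have hx' := Ioo_subset_Icc_self hx
      have := potential_pos hcχ hx'
      have := one_sub_sq_nonneg hx'
      positivity
  intro x hx
  have hcl : closure (Ioo (-1 : ℝ) 1) = Icc (-1) 1 := closure_Ioo (by norm_num)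
  exact Set.EqOn.of_subset_closure (f := f) (g := fun _ => 0) hIoo hf.cont continuousOn_const
    Ioo_subset_Icc_self hcl.ge hx

/-- The solutions that are `C²` up to the end points form a space of dimension at most one. -/
theorem exists_eq_mul (hcχ : c ^ 2 < χ) (hf : IsProlateSolution c χ f f₁ f₂)
    (hg : IsProlateSolution c χ g g₁ g₂) (hne : g 0 ≠ 0 ∨ g₁ 0 ≠ 0) :
    ∃ m : ℝ, f 0 = m * g 0 ∧ f₁ 0 = m * g₁ 0 ∧ ∀ x ∈ Icc (-1 : ℝ) 1, f x = m * g x := by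
  have hw := hf.wronskian_zero hg
  obtain ⟨m, h0, h1⟩ : ∃ m : ℝ, f 0 = m * g 0 ∧ f₁ 0 = m * g₁ 0 := by
    rcases hne with h | h
    · exact ⟨f 0 / g 0, by field_simp, by field_simp; linarith⟩
    · exact ⟨f₁ 0 / g₁ 0, by field_simp; linarith, by field_simp⟩
  refine ⟨m, h0, h1, fun x hx => sub_eq_zero.1 ?_⟩
  exact (hf.sub_const_mul hg m).eq_zero_of_zero_data hcχ (by simp [h0]) (by simp [h1]) x hx

/-! ### Integral identities and the bound on the Cauchy data at `0` -/

lemma integral_one_sub_sq_mul_deriv_sq (hf : IsProlateSolution c χ f f₁ f₂) :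
    ∫ x in (-1 : ℝ)..1, (1 - x ^ 2) * f₁ x ^ 2 =
      ∫ x in (-1 : ℝ)..1, (χ - c ^ 2 * x ^ 2) * f x ^ 2 := by
  have := hf.cont; have := hf.cont₁
  rw [← sub_eq_zero, ← intervalIntegral.integral_sub]
  · refine integral_eq_zero_of_hasDerivAt (G := fun x => (1 - x ^ 2) * (f x * f₁ x))
      (by fun_prop) (by fun_prop) (fun x hx => ?_) (by norm_num)
    refine ((hasDerivAt_one_sub_sq x).mul
      ((hf.hasDerivAt x hx).mul (hf.hasDerivAt₁ x hx))).congr_deriv ?_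
    simp only [Pi.mul_apply]
    linear_combination f x * hf.ode x hx
  all_goals exact intervalIntegrable_of_cont (by fun_prop)

/-- Lower bound for the eigenvalue: from `∫ (χ - c²x²)² f² = ∫ ((1 - x²) f'')² + 2 ∫ (1 - x²) f'²`
and `∫ (1 - x²) f'² = ∫ (χ - c²x²) f²`, where `χ - c²x² ≤ χ`. -/
theorem two_le_eigenvalue (hcχ : c ^ 2 < χ) (hf : IsProlateSolution c χ f f₁ f₂)
    (hpos : 0 < ∫ x in (-1 : ℝ)..1, f x ^ 2) : 2 ≤ χ := by
  have := hf.cont; have := hf.cont₁; have := hf.cont₂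
  have hχ : 0 < χ := lt_of_le_of_lt (sq_nonneg c) hcχ
  have hid : ∫ x in (-1 : ℝ)..1, ((χ - c ^ 2 * x ^ 2) ^ 2 * f x ^ 2 -
      2 * ((1 - x ^ 2) * f₁ x ^ 2) - ((1 - x ^ 2) * f₂ x) ^ 2) = 0 := by
    refine integral_eq_zero_of_hasDerivAt (G := fun x => -(2 * x * ((1 - x ^ 2) * f₁ x ^ 2)))
      (by fun_prop) (by fun_prop) (fun x hx => ?_) (by norm_num)
    refine (((((hasDerivAt_id x).const_mul 2).mul ((hasDerivAt_one_sub_sq x).mul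
      ((hf.hasDerivAt₁ x hx).pow 2)))).neg).congr_deriv ?_
    simp only [Pi.mul_apply, Pi.pow_apply, id]
    push_cast
    linear_combination (-(χ - c ^ 2 * x ^ 2) * f x + (1 - x ^ 2) * f₂ x - 2 * x * f₁ x) * hf.ode x hx
  rw [intervalIntegral.integral_sub (intervalIntegrable_of_cont (by fun_prop)) (intervalIntegrable_of_cont (by fun_prop)),
    intervalIntegral.integral_sub (intervalIntegrable_of_cont (by fun_prop)) (intervalIntegrable_of_cont (by fun_prop)),
    intervalIntegral.integral_const_mul, hf.integral_one_sub_sq_mul_deriv_sq] at hid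
  have hnn : 0 ≤ ∫ x in (-1 : ℝ)..1, ((1 - x ^ 2) * f₂ x) ^ 2 :=
    intervalIntegral.integral_nonneg (by norm_num) fun x _ => sq_nonneg _
  have hle : ∫ x in (-1 : ℝ)..1, (χ - c ^ 2 * x ^ 2) ^ 2 * f x ^ 2 ≤
      ∫ x in (-1 : ℝ)..1, χ * ((χ - c ^ 2 * x ^ 2) * f x ^ 2) := by
    refine intervalIntegral.integral_mono_on (by norm_num) (intervalIntegrable_of_cont (by fun_prop))
      (intervalIntegrable_of_cont (by fun_prop)) fun x hx => ?_
    have hr := potential_pos hcχ hx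
    nlinarith [mul_nonneg (mul_nonneg hr.le (sq_nonneg (f x))) (mul_nonneg (sq_nonneg c) (sq_nonneg x))]
  rw [intervalIntegral.integral_const_mul] at hle
  have hlow : (χ - c ^ 2) * ∫ x in (-1 : ℝ)..1, f x ^ 2 ≤
      ∫ x in (-1 : ℝ)..1, (χ - c ^ 2 * x ^ 2) * f x ^ 2 := by
    rw [← intervalIntegral.integral_const_mul]
    refine intervalIntegral.integral_mono_on (by norm_num) (intervalIntegrable_of_cont (by fun_prop))
      (intervalIntegrable_of_cont (by fun_prop)) fun x hx => ?_
    have : x ^ 2 ≤ 1 := by linarith [one_sub_sq_nonneg hx]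
    gcongr
    nlinarith [mul_le_mul_of_nonneg_left this (sq_nonneg c)]
  have hI := lt_of_lt_of_le (mul_pos (sub_pos.2 hcχ) hpos) hlow
  by_contra hlt
  nlinarith [mul_pos (sub_pos.2 (not_le.1 hlt)) hI]

/-- A virial identity, obtained by integrating `x` against the derivative of the energy
`(1 - x²) (χ - c² x²) f² + ((1 - x²) f')²`. -/
lemma virial (hf : IsProlateSolution c χ f f₁ f₂) :
    ∫ x in (-1 : ℝ)..1, (2 * χ - 4 * (χ + c ^ 2) * x ^ 2 + 6 * c ^ 2 * x ^ 4 +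
      (3 * x ^ 2 - 1)) * f x ^ 2 = 0 := by
  have := hf.cont; have := hf.cont₁
  refine integral_eq_zero_of_hasDerivAt (G := fun x =>
      x * ((1 - x ^ 2) * (χ - c ^ 2 * x ^ 2) * f x ^ 2 + ((1 - x ^ 2) * f₁ x) ^ 2) -
        (1 - x ^ 2) ^ 2 * (f x * f₁ x) - x * ((1 - x ^ 2) * f x ^ 2))
    (by fun_prop) (by fun_prop) (fun x hx => ?_) (by norm_num)
  have hp := hasDerivAt_one_sub_sq x
  have hf0 := hf.hasDerivAt x hx
  have hf1 := hf.hasDerivAt₁ x hx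
  refine (((hasDerivAt_id x).mul (((hp.mul (hasDerivAt_potential c χ x)).mul (hf0.pow 2)).add
    ((hp.mul hf1).pow 2))).sub ((hp.pow 2).mul (hf0.mul hf1)) |>.sub
    ((hasDerivAt_id x).mul (hp.mul (hf0.pow 2)))).congr_deriv ?_
  simp only [Pi.mul_apply, Pi.pow_apply, Pi.add_apply, id]
  push_cast
  linear_combination (2 * x * (1 - x ^ 2) * f₁ x - (1 - x ^ 2) * f x) * hf.ode x hx

/-- The mass of a normalized solution leans away from the origin: its second moment is at least
that of the uniform distribution. This is the virial identity with `x⁴ ≥ (2/3) x² - 1/9`. -/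
theorem third_le_integral_sq_mul_sq (hcχ : c ^ 2 < χ) (hf : IsProlateSolution c χ f f₁ f₂)
    (hnorm : ∫ x in (-1 : ℝ)..1, f x ^ 2 = 1) :
    1 / 3 ≤ ∫ x in (-1 : ℝ)..1, x ^ 2 * f x ^ 2 := by
  have hχ2 : 2 ≤ χ := hf.two_le_eigenvalue hcχ (by rw [hnorm]; exact one_pos)
  have := hf.cont
  have hmono : ∫ x in (-1 : ℝ)..1, ((2 * χ - 1 - 2 / 3 * c ^ 2) * f x ^ 2 -
      (4 * χ - 3) * (x ^ 2 * f x ^ 2)) ≤ ∫ x in (-1 : ℝ)..1, (2 * χ - 4 * (χ + c ^ 2) * x ^ 2 +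
        6 * c ^ 2 * x ^ 4 + (3 * x ^ 2 - 1)) * f x ^ 2 := by
    refine intervalIntegral.integral_mono_on (by norm_num) (intervalIntegrable_of_cont (by fun_prop))
      (intervalIntegrable_of_cont (by fun_prop)) fun x _ => ?_
    have : 0 ≤ c ^ 2 * (x ^ 2 - 1 / 3) ^ 2 * f x ^ 2 := by positivity
    nlinarith
  rw [hf.virial, intervalIntegral.integral_sub (intervalIntegrable_of_cont (by fun_prop)) (intervalIntegrable_of_cont (by fun_prop)),
    intervalIntegral.integral_const_mul, intervalIntegral.integral_const_mul, hnorm] at hmono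
  by_contra hlt
  nlinarith [mul_pos (show 0 < 4 * χ - 3 by linarith) (sub_pos.2 (not_le.1 hlt))]

/-- For a normalized solution `ψ(0)² + ψ'(0)² / χ ≤ 1`: the function
`ψ² + (1 - x²) ψ'² / (χ - c² x²)` is smallest at `0`, and its integral against the weight
`χ - c² x²` is `2 ∫ (χ - c² x²) ψ²`. -/
theorem sq_add_deriv_sq_div_le_one (hcχ : c ^ 2 < χ) (hf : IsProlateSolution c χ f f₁ f₂)
    (hnorm : ∫ x in (-1 : ℝ)..1, f x ^ 2 = 1) : f 0 ^ 2 + f₁ 0 ^ 2 / χ ≤ 1 := by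
  have hχ : 0 < χ := lt_of_le_of_lt (sq_nonneg c) hcχ
  have hc0 := hf.cont; have hc1 := hf.cont₁
  have hr : ∀ x ∈ Icc (-1 : ℝ) 1, χ - c ^ 2 * x ^ 2 ≠ 0 := fun x hx => (potential_pos hcχ hx).ne'
  have hmin : ∀ x ∈ Icc (-1 : ℝ) 1, f 0 ^ 2 + f₁ 0 ^ 2 / χ ≤
      f x ^ 2 + (1 - x ^ 2) * f₁ x ^ 2 / (χ - c ^ 2 * x ^ 2) := by
    intro x hx
    have h := apply_zero_le_of_hasDerivAt_mul
      (Q := fun x => f x ^ 2 + (1 - x ^ 2) * f₁ x ^ 2 / (χ - c ^ 2 * x ^ 2))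
      (g := fun x => (2 * (χ - c ^ 2 * x ^ 2) + 2 * c ^ 2 * (1 - x ^ 2)) * f₁ x ^ 2 /
        (χ - c ^ 2 * x ^ 2) ^ 2) ?_ (fun x hx => ?_) (fun x hx => ?_) hx
    · simpa using h
    · refine (hc0.pow 2).add (ContinuousOn.div ?_ ?_ hr) <;> fun_prop
    · have hx' := Ioo_subset_Icc_self hx
      refine (((hf.hasDerivAt x hx).pow 2).add (((hasDerivAt_one_sub_sq x).mul
        ((hf.hasDerivAt₁ x hx).pow 2)).div (hasDerivAt_potential c χ x) (hr x hx'))).congr_deriv ?_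
      simp only [Pi.mul_apply, Pi.pow_apply]
      have hrx := hr x hx'
      rw [← mul_div_assoc, eq_comm, div_eq_iff (pow_ne_zero 2 hrx), add_mul (_ * f₁ x),
        div_mul_cancel₀ _ (pow_ne_zero 2 hrx)]
      push_cast
      linear_combination (-2 * f₁ x * (χ - c ^ 2 * x ^ 2)) * hf.ode x hx
    · have hx' := Ioo_subset_Icc_self hx
      have := potential_pos hcχ hx'
      have := one_sub_sq_nonneg hx'
      positivity
  have hmono : ∫ x in (-1 : ℝ)..1, (f 0 ^ 2 + f₁ 0 ^ 2 / χ) * (χ - c ^ 2 * x ^ 2) ≤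
      ∫ x in (-1 : ℝ)..1, ((χ - c ^ 2 * x ^ 2) * f x ^ 2 + (1 - x ^ 2) * f₁ x ^ 2) := by
    refine intervalIntegral.integral_mono_on (by norm_num) (intervalIntegrable_of_cont (by fun_prop))
      (intervalIntegrable_of_cont (by fun_prop)) fun x hx => ?_
    refine (mul_le_mul_of_nonneg_right (hmin x hx) (potential_pos hcχ hx).le).trans_eq ?_
    rw [add_mul, div_mul_cancel₀ _ (hr x hx), mul_comm (f x ^ 2)]
  rw [intervalIntegral.integral_add (intervalIntegrable_of_cont (by fun_prop)) (intervalIntegrable_of_cont (by fun_prop)),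
    hf.integral_one_sub_sq_mul_deriv_sq, intervalIntegral.integral_const_mul] at hmono
  have hR : ∫ x in (-1 : ℝ)..1, (χ - c ^ 2 * x ^ 2) = 2 * χ - 2 / 3 * c ^ 2 := by
    rw [intervalIntegral.integral_sub (intervalIntegrable_of_cont (by fun_prop)) (intervalIntegrable_of_cont (by fun_prop)),
      intervalIntegral.integral_const_mul, integral_pow, intervalIntegral.integral_const]
    norm_num
    ring
  have hS : ∫ x in (-1 : ℝ)..1, (χ - c ^ 2 * x ^ 2) * f x ^ 2 =
      χ - c ^ 2 * ∫ x in (-1 : ℝ)..1, x ^ 2 * f x ^ 2 := by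
    simp only [sub_mul, mul_assoc]
    rw [intervalIntegral.integral_sub (intervalIntegrable_of_cont (by fun_prop)) (intervalIntegrable_of_cont (by fun_prop)),
      intervalIntegral.integral_const_mul, intervalIntegral.integral_const_mul, hnorm, mul_one]
  rw [hR, hS] at hmono
  have hB := hf.third_le_integral_sq_mul_sq hcχ hnorm
  by_contra hlt
  nlinarith [mul_le_mul_of_nonneg_left hB (sq_nonneg c),
    mul_pos (sub_pos.2 (not_le.1 hlt)) (show 0 < 2 * χ - 2 / 3 * c ^ 2 by nlinarith [sq_nonneg c])]

end IsProlateSolution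

/-! ### Legendre polynomials -/

section Legendre

open Polynomial

/-- The primitive of `P_{k+1}` given by Rodrigues' formula,
`(1 / (2^(k+1) (k+1)!)) dᵏ/dxᵏ (x² - 1)^(k+1)`. -/
noncomputable def legendrePrimitive (k : ℕ) : ℝ[X] :=
  C (1 / ((2 : ℝ) ^ (k + 1) * ((k + 1).factorial : ℝ))) * derivative^[k] ((X ^ 2 - 1) ^ (k + 1))

lemma legendrePoly_zero : legendrePoly 0 = 1 := by simp [legendrePoly]

lemma legendrePoly_one : legendrePoly 1 = X := by
  have h : (C (2⁻¹ : ℝ)) * 2 = 1 := by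
    rw [show (2 : ℝ[X]) = C 2 from rfl, ← C_mul]; norm_num
  simp only [legendrePoly, Function.iterate_one, pow_one, derivative_sub, derivative_X_pow,
    derivative_one, Nat.factorial_one]
  simp only [one_div, Nat.cast_one, mul_one, Nat.cast_ofNat, C_ofNat, sub_zero]
  linear_combination X * h

lemma derivative_legendrePrimitive (k : ℕ) :
    derivative (legendrePrimitive k) = legendrePoly (k + 1) := by
  rw [legendrePrimitive, derivative_C_mul, legendrePoly, Function.iterate_succ_apply']

lemma C_rodrigues_succ (k : ℕ) :
    (C (1 / ((2 : ℝ) ^ (k + 1) * ((k + 1).factorial : ℝ))) : ℝ[X]) * (2 * (k + 1)) =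
      C (1 / ((2 : ℝ) ^ k * (k.factorial : ℝ))) := by
  rw [show (2 * ((k : ℝ[X]) + 1)) = C (2 * ((k : ℝ) + 1)) by
    simp only [map_mul, map_add, map_natCast, map_ofNat, map_one], ← C_mul]
  congr 1
  rw [Nat.factorial_succ]
  push_cast
  field_simp
  ring

lemma derivative_sq_sub_one_pow (k : ℕ) :
    derivative ((X ^ 2 - 1 : ℝ[X]) ^ (k + 1)) = (2 * ((k : ℝ[X]) + 1)) * ((X ^ 2 - 1) ^ k * X) := by
  rw [derivative_pow_succ]
  simp only [map_add, map_natCast, map_one, derivative_sub, derivative_X_pow, derivative_one,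
    Nat.cast_ofNat, map_ofNat]
  ring

lemma legendrePoly_add_two_eq_X_mul (k : ℕ) :
    legendrePoly (k + 2) = X * legendrePoly (k + 1) + ((k : ℝ[X]) + 1) * legendrePrimitive k := by
  have h := C_rodrigues_succ (k + 1)
  push_cast at h
  rw [legendrePoly, Function.iterate_succ_apply, derivative_sq_sub_one_pow,
    show (2 * (((k + 1 : ℕ) : ℝ[X]) + 1)) = C (2 * ((k : ℝ) + 2)) by
      simp only [map_mul, map_add, map_natCast, map_ofNat]; push_cast; ring,
    iterate_derivative_C_mul, iterate_derivative_mul_X, legendrePoly, legendrePrimitive, ← h]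
  simp only [map_mul, map_add, map_natCast, map_ofNat, nsmul_eq_mul, Nat.add_sub_cancel]
  push_cast
  ring

lemma legendrePoly_add_two_eq_add (k : ℕ) :
    legendrePoly (k + 2) = (2 * (k : ℝ[X]) + 3) * legendrePrimitive k + legendrePoly k := by
  have h1 := C_rodrigues_succ (k + 1)
  have h0 := C_rodrigues_succ k
  push_cast at h1
  have hd : derivative^[2] ((X ^ 2 - 1 : ℝ[X]) ^ (k + 2)) =
      C (2 * ((k : ℝ) + 2) * (2 * k + 3)) * (X ^ 2 - 1) ^ (k + 1) +
        C (2 * ((k : ℝ) + 2) * (2 * (k + 1))) * (X ^ 2 - 1) ^ k := by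
    rw [Function.iterate_succ_apply, derivative_sq_sub_one_pow, Function.iterate_one,
      show (2 * (((k + 1 : ℕ) : ℝ[X]) + 1)) = C (2 * ((k : ℝ) + 2)) by
      simp only [map_mul, map_add, map_natCast, map_ofNat]; push_cast; ring,
      derivative_C_mul, derivative_mul, derivative_sq_sub_one_pow, derivative_X]
    simp only [map_mul, map_add, map_natCast, map_ofNat, map_one]
    ring
  rw [legendrePoly, Function.iterate_add_apply (n := 2), hd, iterate_map_add, iterate_derivative_C_mul,
    iterate_derivative_C_mul, legendrePoly, legendrePrimitive, ← h0, ← h1]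
  simp only [map_mul, map_add, map_natCast, map_ofNat, map_one]
  ring

/-- Bonnet's recursion formula. -/
theorem legendrePoly_bonnet (k : ℕ) :
    ((k : ℝ[X]) + 2) * legendrePoly (k + 2) =
      (2 * (k : ℝ[X]) + 3) * (X * legendrePoly (k + 1)) - ((k : ℝ[X]) + 1) * legendrePoly k := by
  linear_combination (2 * (k : ℝ[X]) + 3) * legendrePoly_add_two_eq_X_mul k -
    ((k : ℝ[X]) + 1) * legendrePoly_add_two_eq_add k

lemma derivative_legendrePoly_succ (k : ℕ) :
    derivative (legendrePoly (k + 1)) =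
      X * derivative (legendrePoly k) + ((k : ℝ[X]) + 1) * legendrePoly k := by
  cases k with
  | zero => simp [legendrePoly_zero, legendrePoly_one]
  | succ k =>
    have h := congrArg derivative (legendrePoly_add_two_eq_X_mul k)
    rw [derivative_add, derivative_mul, derivative_mul, derivative_legendrePrimitive] at h
    simp only [derivative_X, derivative_natCast, derivative_one, derivative_add] at h
    push_cast
    linear_combination h

lemma derivative_legendrePoly_eq (k : ℕ) :
    derivative (legendrePoly k) =
      X * derivative (legendrePoly (k + 1)) - ((k : ℝ[X]) + 1) * legendrePoly (k + 1) := by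
  have h := congrArg derivative (legendrePoly_add_two_eq_add k)
  rw [derivative_add, derivative_mul, derivative_legendrePrimitive] at h
  simp only [derivative_natCast, derivative_ofNat, derivative_add, derivative_mul] at h
  have h' := derivative_legendrePoly_succ (k + 1)
  push_cast at h'
  linear_combination h' - h

/-- Legendre's differential equation. -/
theorem legendrePoly_ode (k : ℕ) :
    (1 - X ^ 2) * derivative (derivative (legendrePoly k)) - 2 * (X * derivative (legendrePoly k)) +
      (k : ℝ[X]) * ((k : ℝ[X]) + 1) * legendrePoly k = 0 := by
  cases k with
  | zero => simp [legendrePoly_zero]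
  | succ k =>
    have h : (1 - X ^ 2) * derivative (legendrePoly (k + 1)) =
        ((k : ℝ[X]) + 1) * (legendrePoly k - X * legendrePoly (k + 1)) := by
      linear_combination derivative_legendrePoly_succ k + X * derivative_legendrePoly_eq k
    have h' := congrArg derivative h
    simp only [derivative_mul, derivative_sub, derivative_one, derivative_X_pow, derivative_X,
      derivative_add, derivative_natCast] at h'
    push_cast at h' ⊢
    simp only [map_ofNat] at h'
    linear_combination h' + ((k : ℝ[X]) + 1) * derivative_legendrePoly_eq k

/-- The coefficient of `P_{j+2}` in `x² P_j`. -/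
noncomputable def sqCoeffUp (j : ℕ) : ℝ := ((j + 1) * (j + 2)) / ((2 * j + 1) * (2 * j + 3))

/-- The coefficient of `P_j` in `x² P_j`. -/
noncomputable def sqCoeffMid (j : ℕ) : ℝ :=
  (j + 1) ^ 2 / ((2 * j + 1) * (2 * j + 3)) + j ^ 2 / ((2 * j + 1) * (2 * j - 1))

/-- The coefficient of `P_{j-2}` in `x² P_j`; it is `0` for `j = 0` and `j = 1`. -/
noncomputable def sqCoeffDown (j : ℕ) : ℝ := (j * (j - 1)) / ((2 * j + 1) * (2 * j - 1))

lemma two_mul_natCast_sub_one_ne_zero (j : ℕ) : (2 * (j : ℝ) - 1) ≠ 0 := by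
  intro h
  have : (2 * j : ℕ) = 1 := by exact_mod_cast (show (2 * (j : ℝ)) = 1 by linarith)
  omega

lemma sqCoeffUp_pos (j : ℕ) : 0 < sqCoeffUp j := by unfold sqCoeffUp; positivity

lemma sqCoeffMid_nonneg (j : ℕ) : 0 ≤ sqCoeffMid j := by
  cases j with
  | zero => norm_num [sqCoeffMid]
  | succ j =>
    have : (0 : ℝ) < 2 * ((j + 1 : ℕ) : ℝ) - 1 := by push_cast; linarith [(j.cast_nonneg : (0:ℝ) ≤ j)]
    unfold sqCoeffMid
    positivity

lemma sqCoeffDown_nonneg (j : ℕ) : 0 ≤ sqCoeffDown j := by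
  cases j with
  | zero => norm_num [sqCoeffDown]
  | succ j =>
    have hj : (0 : ℝ) ≤ j := j.cast_nonneg
    unfold sqCoeffDown
    push_cast
    exact div_nonneg (mul_nonneg (by linarith) (by linarith))
      (mul_nonneg (by linarith) (by linarith))

/-- All Legendre polynomials take the value `1` at `1`, whence this sum. -/
lemma sqCoeff_sum (j : ℕ) : sqCoeffUp j + sqCoeffMid j + sqCoeffDown j = 1 := by
  have := two_mul_natCast_sub_one_ne_zero j
  have h2 : ((j : ℝ) * 2 - 1) ≠ 0 := by rwa [mul_comm]
  have h1 : (2 * (j : ℝ) + 1) ≠ 0 := by positivity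
  have h3 : (2 * (j : ℝ) + 3) ≠ 0 := by positivity
  unfold sqCoeffUp sqCoeffMid sqCoeffDown
  field_simp
  ring

lemma sq_mul_legendrePoly_eval (j : ℕ) (x : ℝ) :
    x ^ 2 * (legendrePoly j).eval x = sqCoeffUp j * (legendrePoly (j + 2)).eval x +
      sqCoeffMid j * (legendrePoly j).eval x + sqCoeffDown j * (legendrePoly (j - 2)).eval x := by
  have hb : ∀ k : ℕ, ((k : ℝ) + 2) * (legendrePoly (k + 2)).eval x =
      (2 * k + 3) * (x * (legendrePoly (k + 1)).eval x) - (k + 1) * (legendrePoly k).eval x := by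
    intro k
    simpa using congrArg (eval x) (legendrePoly_bonnet k)
  match j with
  | 0 =>
    have h := hb 0
    norm_num [legendrePoly_zero, legendrePoly_one, sqCoeffUp, sqCoeffMid, sqCoeffDown] at h ⊢
    linarith
  | 1 =>
    have h0 := hb 0
    have h1 := hb 1
    norm_num [legendrePoly_zero, legendrePoly_one, sqCoeffUp, sqCoeffMid, sqCoeffDown] at h0 h1 ⊢
    linear_combination -(2 / 15) * h1 - x * h0 / 3
  | i + 2 =>
    have h0 := hb i
    have h1 := hb (i + 1)
    have h2 := hb (i + 2)
    rw [Nat.add_sub_cancel]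
    unfold sqCoeffUp sqCoeffMid sqCoeffDown
    push_cast at h0 h1 h2 ⊢
    have e1 : x * (legendrePoly (i + 2)).eval x = ((i + 3) * (legendrePoly (i + 3)).eval x +
        (i + 2) * (legendrePoly (i + 1)).eval x) / (2 * i + 5) := by
      rw [eq_div_iff (by positivity)]
      linear_combination -h1
    have e2 : x * (legendrePoly (i + 3)).eval x = ((i + 4) * (legendrePoly (i + 4)).eval x +
        (i + 3) * (legendrePoly (i + 2)).eval x) / (2 * i + 7) := by
      rw [eq_div_iff (by positivity)]
      linear_combination -h2
    have e0 : x * (legendrePoly (i + 1)).eval x = ((i + 2) * (legendrePoly (i + 2)).eval x +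
        (i + 1) * (legendrePoly i).eval x) / (2 * i + 3) := by
      rw [eq_div_iff (by positivity)]
      linear_combination -h0
    have e : x ^ 2 * (legendrePoly (i + 2)).eval x =
        ((i + 3) * (x * (legendrePoly (i + 3)).eval x) +
          (i + 2) * (x * (legendrePoly (i + 1)).eval x)) / (2 * i + 5) := by
      rw [pow_two, mul_assoc, e1]
      ring
    rw [e, e2, e0, show (2 * ((i : ℝ) + 2) - 1) = 2 * i + 3 by ring]
    have h5 : (2 * (i : ℝ) + 5) ≠ 0 := by positivity
    have h7 : (2 * (i : ℝ) + 7) ≠ 0 := by positivity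
    have h3 : (2 * (i : ℝ) + 3) ≠ 0 := by positivity
    rw [show (2 * ((i : ℝ) + 2) + 1) = 2 * i + 5 by ring,
      show (2 * ((i : ℝ) + 2) + 3) = 2 * i + 7 by ring]
    field_simp
    ring

/-- The leading coefficient of the Legendre polynomial `P_k`. -/
noncomputable def legendreLead (k : ℕ) : ℝ := (k.centralBinom : ℝ) / 2 ^ k

lemma legendreLead_succ (k : ℕ) :
    ((k : ℝ) + 1) * legendreLead (k + 1) = (2 * k + 1) * legendreLead k := by
  have h : ((k : ℝ) + 1) * (k + 1).centralBinom = 2 * (2 * k + 1) * k.centralBinom := by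
    exact_mod_cast Nat.succ_mul_centralBinom_succ k
  unfold legendreLead
  rw [pow_succ]
  field_simp
  linarith

lemma legendreLead_nonneg (k : ℕ) : 0 ≤ legendreLead k := by unfold legendreLead; positivity

lemma sqCoeffUp_mul_legendreLead (j : ℕ) :
    sqCoeffUp j * legendreLead (j + 2) = legendreLead j := by
  have h0 := legendreLead_succ j
  have h1 := legendreLead_succ (j + 1)
  push_cast at h1
  unfold sqCoeffUp
  rw [div_mul_eq_mul_div, div_eq_iff (by positivity)]
  linear_combination ((j : ℝ) + 1) * h1 + (2 * (j : ℝ) + 3) * h0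

/-- The sequence `(k + 1/2) (ℓ_k / 2^k)²`, with `ℓ_k` the leading coefficient of `P_k`, decreases, and is `3/8` at `k = 1`. -/
lemma sqrt_mul_legendreLead_le {k : ℕ} (hk : 0 < k) :
    Real.sqrt ((k : ℝ) + 1 / 2) * legendreLead k ≤ Real.sqrt (5 / (4 * Real.pi)) * 2 ^ k := by
  have key : ∀ m : ℕ, ((m : ℝ) + 3 / 2) * legendreLead (m + 1) ^ 2 ≤ 3 / 8 * (2 ^ (m + 1)) ^ 2 := by
    intro m
    induction m with
    | zero => norm_num [legendreLead, Nat.centralBinom]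
    | succ m ih =>
      have h := legendreLead_succ (m + 1)
      push_cast at h ⊢
      have hm : (0 : ℝ) ≤ m := m.cast_nonneg
      have h' : legendreLead (m + 1 + 1) = (2 * (m : ℝ) + 3) / (m + 2) * legendreLead (m + 1) := by
        rw [div_mul_eq_mul_div, eq_div_iff (by positivity)]
        linear_combination h
      have hfac : ((m : ℝ) + 1 + 3 / 2) * ((2 * (m : ℝ) + 3) / (m + 2)) ^ 2 ≤
          4 * ((m : ℝ) + 3 / 2) := by
        rw [div_pow, mul_div_assoc', div_le_iff₀ (by positivity)]
        nlinarith
      calc ((m : ℝ) + 1 + 3 / 2) * legendreLead (m + 1 + 1) ^ 2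
          = ((m : ℝ) + 1 + 3 / 2) * ((2 * (m : ℝ) + 3) / (m + 2)) ^ 2 *
              legendreLead (m + 1) ^ 2 := by rw [h']; ring
        _ ≤ 4 * ((m : ℝ) + 3 / 2) * legendreLead (m + 1) ^ 2 := by gcongr
        _ ≤ 4 * (3 / 8 * (2 ^ (m + 1)) ^ 2) := by linarith
        _ = _ := by ring
  obtain ⟨m, rfl⟩ := Nat.exists_eq_add_of_lt hk
  have h := key m
  have hπ : (3 / 8 : ℝ) ≤ 5 / (4 * Real.pi) := by
    rw [le_div_iff₀ (by positivity)]
    linarith [Real.pi_lt_d2]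
  have h2 : (0 : ℝ) ≤ 2 ^ (0 + m + 1) := by positivity
  rw [← Real.sqrt_sq (legendreLead_nonneg _), ← Real.sqrt_mul (by positivity),
    ← Real.sqrt_sq h2, ← Real.sqrt_mul (by positivity)]
  apply Real.sqrt_le_sqrt
  simp only [zero_add]
  push_cast
  have : (3 / 8 : ℝ) * (2 ^ (m + 1)) ^ 2 ≤ 5 / (4 * Real.pi) * (2 ^ (m + 1)) ^ 2 := by gcongr
  linarith

end Legendre

/-! ### The Legendre coefficients of a solution -/

/-- The recurrence satisfied by the Legendre coefficients of a solution keeps them of one sign and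
nondecreasing in absolute value along each parity class `j = e, e + 2, …`, as long as
`j (j + 1) + c² ≤ χ` (this uses `x² P_j = A P_{j+2} + B P_j + C P_{j-2}` with `A + B + C = 1`).
Dropping the nonnegative terms from the recurrence then leaves `c² A γ_{j+2} ≤ χ γ_j`. -/
lemma nonneg_and_le_of_recurrence {c χ : ℝ} (hc : 0 < c) {γ : ℕ → ℝ} {k e : ℕ}
    (hrec : ∀ j : ℕ, (χ - j * (j + 1)) * γ j =
      c ^ 2 * (sqCoeffUp j * γ (j + 2) + sqCoeffMid j * γ j + sqCoeffDown j * γ (j - 2)))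
    (hχ : (k : ℝ) * (k - 1) + c ^ 2 ≤ χ) (he : e ≤ 1) (h0 : 0 ≤ γ e) (i : ℕ) (hi : e + 2 * i ≤ k) :
    0 ≤ γ (e + 2 * i) ∧ 0 ≤ sqCoeffDown (e + 2 * i) * γ (e + 2 * i - 2) ∧
      sqCoeffDown (e + 2 * i) * γ (e + 2 * i - 2) ≤ sqCoeffDown (e + 2 * i) * γ (e + 2 * i) ∧
      γ (e + 2 * i) ≤ legendreLead (e + 2 * i) * (χ / c ^ 2) ^ i * γ e := by
  induction i with
  | zero =>
    have hD : sqCoeffDown e = 0 := by interval_cases e <;> simp [sqCoeffDown]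
    have hL : legendreLead e = 1 := by interval_cases e <;> norm_num [legendreLead, Nat.centralBinom]
    simp [hD, hL, h0]
  | succ i ih =>
    obtain ⟨hpos, hD0, hD1, hle⟩ := ih (by omega)
    have hrj := hrec (e + 2 * i)
    have hjk : e + 2 * i + 2 ≤ k := by omega
    rw [show e + 2 * (i + 1) = e + 2 * i + 2 by ring, Nat.add_sub_cancel]
    set j := e + 2 * i
    have hj0 : (0 : ℝ) ≤ j := j.cast_nonneg
    have hjk' : (j : ℝ) + 2 ≤ k := by exact_mod_cast hjk
    have hj : (j : ℝ) * (j + 1) + c ^ 2 ≤ χ := by nlinarith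
    have hA := sqCoeffUp_pos j
    have hc2 : 0 < c ^ 2 := by positivity
    have hcA : 0 < c ^ 2 * sqCoeffUp j := by positivity
    have hsum := sqCoeff_sum j
    have hmono : γ j ≤ γ (j + 2) := by
      refine le_of_mul_le_mul_left ?_ hcA
      have h1 : c ^ 2 * γ j ≤ (χ - j * (j + 1)) * γ j := by gcongr; linarith
      have h2 := mul_le_mul_of_nonneg_left hD1 hc2.le
      have h3 : c ^ 2 * sqCoeffUp j * γ j = c ^ 2 * γ j - c ^ 2 * (sqCoeffMid j * γ j) -
          c ^ 2 * (sqCoeffDown j * γ j) := by linear_combination c ^ 2 * γ j * hsum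
      linarith
    refine ⟨hpos.trans hmono, mul_nonneg (sqCoeffDown_nonneg _) hpos,
      mul_le_mul_of_nonneg_left hmono (sqCoeffDown_nonneg _), ?_⟩
    refine le_of_mul_le_mul_left (?_ : c ^ 2 * sqCoeffUp j * γ (j + 2) ≤ _) hcA
    have h1 : c ^ 2 * sqCoeffUp j * γ (j + 2) ≤ χ * γ j := by
      have := mul_nonneg hc2.le (mul_nonneg (sqCoeffMid_nonneg j) hpos)
      have := mul_nonneg hc2.le hD0
      have : 0 ≤ (j : ℝ) * (j + 1) * γ j := by positivity
      linarith
    have hχ0 : 0 ≤ χ := by nlinarith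
    calc c ^ 2 * sqCoeffUp j * γ (j + 2) ≤ χ * γ j := h1
      _ ≤ χ * (legendreLead j * (χ / c ^ 2) ^ i * γ e) := by gcongr
      _ = c ^ 2 * sqCoeffUp j * (legendreLead (j + 2) * (χ / c ^ 2) ^ (i + 1) * γ e) := by
        rw [← sqCoeffUp_mul_legendreLead j, pow_succ (χ / c ^ 2) i]
        field_simp

lemma abs_le_of_recurrence {c χ : ℝ} (hc : 0 < c) {γ : ℕ → ℝ} {e i : ℕ}
    (hrec : ∀ j : ℕ, (χ - j * (j + 1)) * γ j =
      c ^ 2 * (sqCoeffUp j * γ (j + 2) + sqCoeffMid j * γ j + sqCoeffDown j * γ (j - 2)))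
    (hχ : ((e + 2 * i : ℕ) : ℝ) * ((e + 2 * i : ℕ) - 1) + c ^ 2 ≤ χ) (he : e ≤ 1) :
    |γ (e + 2 * i)| ≤ legendreLead (e + 2 * i) * (χ / c ^ 2) ^ i * |γ e| := by
  rcases le_total 0 (γ e) with h | h
  · obtain ⟨h1, -, -, h2⟩ := nonneg_and_le_of_recurrence hc hrec hχ he h i le_rfl
    rwa [abs_of_nonneg h1, abs_of_nonneg h]
  · obtain ⟨h1, -, -, h2⟩ := nonneg_and_le_of_recurrence (γ := fun j => -γ j) hc
      (fun j => by linear_combination -hrec j) hχ he (neg_nonneg.2 h) i le_rfl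
    rwa [← abs_neg, abs_of_nonneg h1, abs_of_nonpos h]

lemma IsProlateSolution.legendre_recurrence {c χ : ℝ} {f f₁ f₂ : ℝ → ℝ}
    (hf : IsProlateSolution c χ f f₁ f₂) (j : ℕ) :
    (χ - j * (j + 1)) * ∫ x in (-1 : ℝ)..1, f x * (legendrePoly j).eval x =
      c ^ 2 * (sqCoeffUp j * (∫ x in (-1 : ℝ)..1, f x * (legendrePoly (j + 2)).eval x) +
        sqCoeffMid j * (∫ x in (-1 : ℝ)..1, f x * (legendrePoly j).eval x) +
        sqCoeffDown j * ∫ x in (-1 : ℝ)..1, f x * (legendrePoly (j - 2)).eval x) := by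
  have hc0 := hf.cont; have hc1 := hf.cont₁
  -- Green's formula for `f` and `P_j`
  have h : ∫ x in (-1 : ℝ)..1, ((χ - j * (j + 1)) * (f x * (legendrePoly j).eval x) -
      c ^ 2 * (sqCoeffUp j * (f x * (legendrePoly (j + 2)).eval x) +
        sqCoeffMid j * (f x * (legendrePoly j).eval x) +
        sqCoeffDown j * (f x * (legendrePoly (j - 2)).eval x))) = 0 := by
    refine integral_eq_zero_of_hasDerivAt (G := fun x => (1 - x ^ 2) *
        ((legendrePoly j).derivative.eval x * f x - (legendrePoly j).eval x * f₁ x))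
      (by fun_prop) (by fun_prop) (fun x hx => ?_) (by norm_num)
    refine ((hasDerivAt_one_sub_sq x).mul
      ((((legendrePoly j).derivative.hasDerivAt x).mul (hf.hasDerivAt x hx)).sub
        (((legendrePoly j).hasDerivAt x).mul (hf.hasDerivAt₁ x hx)))).congr_deriv ?_
    have hode : (1 - x ^ 2) * (legendrePoly j).derivative.derivative.eval x -
        2 * (x * (legendrePoly j).derivative.eval x) +
        j * (j + 1) * (legendrePoly j).eval x = 0 := by
      simpa using congrArg (Polynomial.eval x) (legendrePoly_ode j)
    simp only [Pi.mul_apply, Pi.sub_apply]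
    linear_combination f x * hode - (legendrePoly j).eval x * hf.ode x hx -
      c ^ 2 * f x * sq_mul_legendrePoly_eval j x
  rw [intervalIntegral.integral_sub (intervalIntegrable_of_cont (by fun_prop)) (intervalIntegrable_of_cont (by fun_prop)),
    intervalIntegral.integral_const_mul, intervalIntegral.integral_const_mul,
    intervalIntegral.integral_add (intervalIntegrable_of_cont (by fun_prop)) (intervalIntegrable_of_cont (by fun_prop)),
    intervalIntegral.integral_add (intervalIntegrable_of_cont (by fun_prop)) (intervalIntegrable_of_cont (by fun_prop)),
    intervalIntegral.integral_const_mul, intervalIntegral.integral_const_mul,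
    intervalIntegral.integral_const_mul] at h
  linarith

/-! ### The finite Fourier transform of a solution -/

lemma hasDerivAt_integral_kernel (c : ℝ) {K K₁ g : ℝ → ℝ} (hK : ∀ t, HasDerivAt K (K₁ t) t)
    (hK₁ : Continuous K₁) (hb : ∀ t, |K₁ t| ≤ 1) (hg : ContinuousOn g (Icc (-1) 1)) (x : ℝ) :
    HasDerivAt (fun x => ∫ y in (-1 : ℝ)..1, K (c * x * y) * g y)
      (∫ y in (-1 : ℝ)..1, K₁ (c * x * y) * (c * y * g y)) x := by
  have hKc : Continuous K := continuous_iff_continuousAt.2 fun t => (hK t).continuousAt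
  have hint0 : ∀ z : ℝ, IntervalIntegrable (fun y => K (c * z * y) * g y)
      MeasureTheory.volume (-1) 1 := fun z => intervalIntegrable_of_cont (by fun_prop)
  have hint1 : IntervalIntegrable (fun y => K₁ (c * x * y) * (c * y * g y))
      MeasureTheory.volume (-1) 1 := intervalIntegrable_of_cont (by fun_prop)
  refine (intervalIntegral.hasDerivAt_integral_of_dominated_loc_of_deriv_le
    (F := fun x y => K (c * x * y) * g y) (F' := fun x y => K₁ (c * x * y) * (c * y * g y))
    (bound := fun y => |c * y * g y|) (s := univ) Filter.univ_mem
    (Filter.Eventually.of_forall fun z => (hint0 z).def'.aestronglyMeasurable)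
    (hint0 x) hint1.def'.aestronglyMeasurable ?_ (intervalIntegrable_of_cont (by fun_prop)) ?_).2
  · refine Filter.Eventually.of_forall fun y _ z _ => ?_
    rw [Real.norm_eq_abs, abs_mul]
    exact mul_le_of_le_one_left (abs_nonneg _) (hb _)
  · refine Filter.Eventually.of_forall fun y _ z _ => ?_
    have hl : HasDerivAt (fun z => c * z * y) (c * y) z :=
      (((hasDerivAt_id z).const_mul c).mul_const y).congr_deriv (by ring)
    exact (((hK (c * z * y)).comp z hl).mul_const (g y)).congr_deriv (by ring)

/-- The operator `L_c` commutes with the integral operators of kernel `K(cxy)` where `K'' = -K`,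
such as the cosine and sine transforms, since `L_c` acts on the kernel in the same way in both
variables; hence these transforms map solutions to solutions. -/
theorem IsProlateSolution.integral_kernel {c χ : ℝ} {f f₁ f₂ K K₁ : ℝ → ℝ}
    (hf : IsProlateSolution c χ f f₁ f₂) (hK : ∀ t, HasDerivAt K (K₁ t) t)
    (hK₁ : ∀ t, HasDerivAt K₁ (-K t) t) (hb : ∀ t, |K t| ≤ 1) (hb₁ : ∀ t, |K₁ t| ≤ 1) :
    IsProlateSolution c χ (fun x => ∫ y in (-1 : ℝ)..1, K (c * x * y) * f y)
      (fun x => ∫ y in (-1 : ℝ)..1, K₁ (c * x * y) * (c * y * f y))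
      (fun x => ∫ y in (-1 : ℝ)..1, -K (c * x * y) * (c * y * (c * y * f y))) := by
  have hKc : Continuous K := continuous_iff_continuousAt.2 fun t => (hK t).continuousAt
  have hK₁c : Continuous K₁ := continuous_iff_continuousAt.2 fun t => (hK₁ t).continuousAt
  have hc0 := hf.cont; have hc1 := hf.cont₁
  have d0 := hasDerivAt_integral_kernel c hK hK₁c hb₁ hc0
  have d1 := hasDerivAt_integral_kernel c (g := fun y => c * y * f y) hK₁ hKc.neg
    (fun t => by rw [abs_neg]; exact hb t) (by fun_prop)
  have d2 := hasDerivAt_integral_kernel c (g := fun y => c * y * (c * y * f y))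
    (fun t => (hK t).neg) hK₁c.neg (fun t => by rw [abs_neg]; exact hb₁ t)
    (by fun_prop)
  refine ⟨fun x _ => (d0 x).continuousAt.continuousWithinAt,
    fun x _ => (d1 x).continuousAt.continuousWithinAt,
    fun x _ => (d2 x).continuousAt.continuousWithinAt, fun x _ => d0 x, fun x _ => d1 x,
    fun x _ => ?_⟩
  -- Green's formula in `y` for `f` and the kernel
  have h : ∫ y in (-1 : ℝ)..1, ((1 - x ^ 2) * (-K (c * x * y) * (c * y * (c * y * f y))) -
      2 * x * (K₁ (c * x * y) * (c * y * f y)) +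
      (χ - c ^ 2 * x ^ 2) * (K (c * x * y) * f y)) = 0 := by
    refine integral_eq_zero_of_hasDerivAt (G := fun y => (1 - y ^ 2) *
        (c * x * (K₁ (c * x * y) * f y) - K (c * x * y) * f₁ y))
      (by fun_prop) (by fun_prop) (fun y hy => ?_) (by norm_num)
    have hl : HasDerivAt (fun y => c * x * y) (c * x) y :=
      ((hasDerivAt_id y).const_mul (c * x)).congr_deriv (by ring)
    refine ((hasDerivAt_one_sub_sq y).mul
      (((((hK₁ (c * x * y)).comp y hl).mul (hf.hasDerivAt y hy)).const_mul (c * x)).sub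
        (((hK (c * x * y)).comp y hl).mul (hf.hasDerivAt₁ y hy)))).congr_deriv ?_
    simp only [Pi.mul_apply, Pi.sub_apply, Function.comp_apply]
    linear_combination -K (c * x * y) * hf.ode y hy
  rwa [intervalIntegral.integral_add (intervalIntegrable_of_cont (by fun_prop)) (intervalIntegrable_of_cont (by fun_prop)),
    intervalIntegral.integral_sub (intervalIntegrable_of_cont (by fun_prop)) (intervalIntegrable_of_cont (by fun_prop)),
    intervalIntegral.integral_const_mul, intervalIntegral.integral_const_mul,
    intervalIntegral.integral_const_mul] at h

lemma finiteFourier_eq_cos_add_sin (c : ℝ) {f : ℝ → ℝ} (hf : ContinuousOn f (Icc (-1) 1)) (x : ℝ) :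
    finiteFourier c f x = ((∫ y in (-1 : ℝ)..1, Real.cos (c * x * y) * f y : ℝ) : ℂ) +
      ((∫ y in (-1 : ℝ)..1, Real.sin (c * x * y) * f y : ℝ) : ℂ) * Complex.I := by
  rw [← intervalIntegral.integral_ofReal, ← intervalIntegral.integral_ofReal,
    ← intervalIntegral.integral_mul_const, ← intervalIntegral.integral_add, finiteFourier]
  · refine intervalIntegral.integral_congr fun y _ => ?_
    rw [show Complex.I * c * x * y = ((c * x * y : ℝ) : ℂ) * Complex.I by push_cast; ring,
      Complex.exp_mul_I]
    push_cast
    ring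
  all_goals
    refine ContinuousOn.intervalIntegrable_of_Icc (by norm_num) ?_
    fun_prop

/-- A solution with nonzero Cauchy data at `0` is an eigenfunction of the finite Fourier transform;
its first two moments are given by the eigenvalue and the Cauchy data. -/
theorem IsProlateSolution.exists_finiteFourier_eq {c χ : ℝ} (hc : 0 < c) (hcχ : c ^ 2 < χ)
    {f f₁ f₂ : ℝ → ℝ} (hf : IsProlateSolution c χ f f₁ f₂) (hne : f 0 ≠ 0 ∨ f₁ 0 ≠ 0) :
    ∃ μ : ℂ, (∀ x ∈ Icc (-1 : ℝ) 1, finiteFourier c f x = μ * (f x : ℂ)) ∧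
      |∫ y in (-1 : ℝ)..1, f y| ≤ ‖μ‖ * |f 0| ∧
      c * |∫ y in (-1 : ℝ)..1, f y * y| ≤ ‖μ‖ * |f₁ 0| := by
  have hcos := hf.integral_kernel (K := Real.cos) (K₁ := fun t => -Real.sin t)
    Real.hasDerivAt_cos (fun t => (Real.hasDerivAt_sin t).neg) Real.abs_cos_le_one
    (fun t => by rw [abs_neg]; exact Real.abs_sin_le_one t)
  have hsin := hf.integral_kernel (K := Real.sin) (K₁ := Real.cos)
    Real.hasDerivAt_sin Real.hasDerivAt_cos Real.abs_sin_le_one Real.abs_cos_le_one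
  obtain ⟨a, ha0, -, ha⟩ := hcos.exists_eq_mul hcχ hf hne
  obtain ⟨b, -, hb1, hb⟩ := hsin.exists_eq_mul hcχ hf hne
  have hre : |a| ≤ ‖(a + b * Complex.I : ℂ)‖ := by
    simpa using Complex.abs_re_le_norm (a + b * Complex.I : ℂ)
  have him : |b| ≤ ‖(a + b * Complex.I : ℂ)‖ := by
    simpa using Complex.abs_im_le_norm (a + b * Complex.I : ℂ)
  refine ⟨a + b * Complex.I, fun x hx => ?_, ?_, ?_⟩
  · rw [finiteFourier_eq_cos_add_sin c hf.cont, ha x hx, hb x hx]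
    push_cast
    ring
  · simp only [mul_zero, zero_mul, Real.cos_zero, one_mul] at ha0
    rw [ha0, abs_mul]
    gcongr
  · simp only [mul_zero, zero_mul, Real.cos_zero, one_mul, mul_assoc,
      intervalIntegral.integral_const_mul] at hb1
    simp only [mul_comm (f _)]
    rw [← abs_of_pos hc, ← abs_mul, hb1, abs_mul]
    gcongr

/-! ### The bounds on the Legendre coefficients -/

lemma legendreCoeff_eq (ψ : ℝ → ℝ) (k : ℕ) :
    legendreCoeff ψ k =
      Real.sqrt ((k : ℝ) + 1 / 2) * ∫ x in (-1 : ℝ)..1, ψ x * (legendrePoly k).eval x := by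
  rw [legendreCoeff, ← intervalIntegral.integral_const_mul]
  refine intervalIntegral.integral_congr fun x _ => ?_
  simp only [normalizedLegendre]
  ring

theorem proposition2 (c : ℝ) (hc : 0 < c) (n k : ℕ) (hn : 0 < n) (hk : 0 < k)
    (χ : ℝ) (ψ : ℝ → ℝ) (hψ : IsPSWF c n χ ψ)
    (hχ : (k : ℝ) * ((k : ℝ) - 1) + 1.13 * c ^ 2 ≤ χ) :
    ∃ μ : ℂ, (∀ x ∈ Icc (-1 : ℝ) 1, finiteFourier c ψ x = μ * (ψ x : ℂ)) ∧
      |legendreCoeff ψ 0| ≤ 1 / Real.sqrt 2 * ‖μ‖ ∧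
      |legendreCoeff ψ k| ≤
        Real.sqrt (5 / (4 * Real.pi)) * (2 / Real.sqrt (c ^ 2 / χ)) ^ k * ‖μ‖ := by
  obtain ⟨ψ₁, ψ₂, hf⟩ := hψ.eigenfunction.exists_isProlateSolution
  have hc2 : 0 < c ^ 2 := by positivity
  have hk1 : (1 : ℝ) ≤ k := by exact_mod_cast hk
  have hcχ : c ^ 2 < χ := by nlinarith
  have hχ0 : 0 < χ := hc2.trans hcχ
  have hne : ψ 0 ≠ 0 ∨ ψ₁ 0 ≠ 0 := by
    rcases Nat.even_or_odd n with h | h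
    · exact Or.inl (hψ.sign_even h).ne'
    · have := hψ.sign_odd h
      rw [(hf.hasDerivAt 0 (by norm_num)).deriv] at this
      exact Or.inr this.ne'
  obtain ⟨μ, hμ, hm0, hm1⟩ := hf.exists_finiteFourier_eq hc hcχ hne
  have hA := hf.sq_add_deriv_sq_div_le_one hcχ hψ.normalized
  have hψ0 : |ψ 0| ≤ 1 := by
    rw [abs_le_one_iff_mul_self_le_one]
    nlinarith [show 0 ≤ ψ₁ 0 ^ 2 / χ by positivity]
  have hψ1 : |ψ₁ 0| ≤ Real.sqrt χ := by
    apply Real.abs_le_sqrt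
    rw [← div_le_one hχ0]
    nlinarith [sq_nonneg (ψ 0)]
  set γ : ℕ → ℝ := fun j => ∫ x in (-1 : ℝ)..1, ψ x * (legendrePoly j).eval x with hγ
  have hγ0 : |γ 0| ≤ ‖μ‖ := by
    simp only [hγ, legendrePoly_zero, Polynomial.eval_one, mul_one]
    exact hm0.trans (mul_le_of_le_one_right (norm_nonneg _) hψ0)
  set s : ℝ := Real.sqrt χ / c with hs
  have hs2 : χ / c ^ 2 = s ^ 2 := by rw [hs, div_pow, Real.sq_sqrt hχ0.le]
  have hγ1 : |γ 1| ≤ s * ‖μ‖ := by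
    simp only [hγ, legendrePoly_one, Polynomial.eval_X]
    rw [hs, div_mul_eq_mul_div, le_div_iff₀ hc, mul_comm _ c, mul_comm (Real.sqrt χ)]
    exact hm1.trans (by gcongr)
  refine ⟨μ, hμ, ?_, ?_⟩
  · rw [legendreCoeff_eq, abs_mul, abs_of_nonneg (Real.sqrt_nonneg _)]
    have : Real.sqrt (((0 : ℕ) : ℝ) + 1 / 2) = 1 / Real.sqrt 2 := by simp
    rw [this]
    gcongr
  · have hbase : 2 / Real.sqrt (c ^ 2 / χ) = 2 * s := by
      rw [Real.sqrt_div hc2.le, Real.sqrt_sq hc.le, hs]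
      field_simp
    -- the bound for the unnormalized coefficient, from either parity class
    have hγk : |γ k| ≤ legendreLead k * s ^ k * ‖μ‖ := by
      have hχ' : (k : ℝ) * ((k : ℝ) - 1) + c ^ 2 ≤ χ := by linarith
      have hL := legendreLead_nonneg k
      have hs0 : 0 ≤ s := by positivity
      rcases Nat.even_or_odd' k with ⟨i, hi | hi⟩
      · have hk' : k = 0 + 2 * i := by omega
        have h := abs_le_of_recurrence (e := 0) (i := i) hc hf.legendre_recurrence
          (by rwa [← hk']) zero_le_one
        rw [← hk', hs2, ← pow_mul, ← hi] at h
        exact h.trans (by gcongr)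
      · have hk' : k = 1 + 2 * i := by omega
        have h := abs_le_of_recurrence (e := 1) (i := i) hc hf.legendre_recurrence
          (by rwa [← hk']) le_rfl
        rw [← hk', hs2, ← pow_mul] at h
        calc |γ k| ≤ legendreLead k * s ^ (2 * i) * |γ 1| := h
          _ ≤ legendreLead k * s ^ (2 * i) * (s * ‖μ‖) := by gcongr
          _ = legendreLead k * s ^ k * ‖μ‖ := by rw [hi]; ring
    rw [legendreCoeff_eq, abs_mul, abs_of_nonneg (Real.sqrt_nonneg _), hbase, mul_pow]
    have hs0 : 0 ≤ s := by positivity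
    calc Real.sqrt ((k : ℝ) + 1 / 2) * |γ k|
        ≤ Real.sqrt ((k : ℝ) + 1 / 2) * (legendreLead k * s ^ k * ‖μ‖) := by gcongr
      _ = (Real.sqrt ((k : ℝ) + 1 / 2) * legendreLead k) * s ^ k * ‖μ‖ := by ring
      _ ≤ (Real.sqrt (5 / (4 * Real.pi)) * 2 ^ k) * s ^ k * ‖μ‖ := by
        have := sqrt_mul_legendreLead_le hk
        gcongr ?_ * _ * _
      _ = Real.sqrt (5 / (4 * Real.pi)) * (2 ^ k * s ^ k) * ‖μ‖ := by ring
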